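/- Let $N\ge 1$, let $\Omega\subset\mathbb R^N$ be a nonempty open set (for instance a bounded one with Lipschitz boundary), put $C\Omega=\mathbb R^N\setminus\Omega$, and let $\beta\in L^\infty(C\Omega)$ with $\beta\ge 0$ a.e. in $C\Omega$. For $i=1,2$ let $s_i:\mathbb R^N\times\mathbb R^N\to(0,1)$ be continuous and symmetric with $0<\inf s_i\le\sup s_i<1$, and let $a^i:\mathbb R^N\times\mathbb R^N\times\mathbb R\to\mathbb R$ satisfy $a^i(x,y,t)=a^i(y,x,t)$ for all $x,y,t$, such that for every $t>0$ the functions $(x,y)\mapsto a^i(x,y,t)$ and $x\mapsto a^i(x,x,t)$ are Lebesgue measurable. Define $$\varphi^i_{x,y}(t)=a^i(x,y,|t|)\,t\ \ (t\ne0),\qquad \varphi^i_{x,y}(0)=0,\qquad \varPhi^i_{x,y}(t)=\int_0^t\varphi^i_{x,y}(\tau)\,d\tau\ \ (t\ge0),\qquad \widehat\varPhi^i_x=\varPhi^i_{x,x}.$$ Assume that for all $x,y\in\mathbb R^N$: * $\varphi^i_{x,y}$ is an increasing homeomorphism of $\mathbb R$ onto itself; * $1<\varphi_i^-\le \dfrac{t\,\varphi^i_{x,y}(t)}{\varPhi^i_{x,y}(t)}\le\varphi_i^+<\infty$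 for all $t>0$, with constants $\varphi_i^\pm$ independent of $x,y,t$; * $t\mapsto\varPhi^i_{x,y}(\sqrt t)$ is convex on $[0,\infty)$. For measurable $u:\mathbb R^N\to\mathbb R$ put $\|u\|_{X_i}=[u]_i+\|u\|_{i,\Omega}+\|u\|_{i,\beta,C\Omega}\in[0,\infty]$, where $$[u]_i=\inf\Big\{\lambda>0:\int_{\mathbb R^{2N}\setminus(C\Omega)^2}\varPhi^i_{x,y}\Big(\frac{|u(x)-u(y)|}{\lambda|x-y|^{s_i(x,y)}}\Big)\frac{dx\,dy}{|x-y|^N}\le1\Big\},$$ $$\|u\|_{i,\Omega}=\inf\Big\{\lambda>0:\int_\Omega\widehat\varPhi^i_x\Big(\frac{|u(x)|}{\lambda}\Big)dx\le1\Big\},\qquad \|u\|_{i,\beta,C\Omega}=\inf\Big\{\lambda>0:\int_{C\Omega}\beta(x)\,\widehat\varPhi^i_x\Big(\frac{|u(x)|}{\lambda}\Big)dx\le1\Big\}$$ (with $\inf\varnothing=\infty$), and let $X_i$ be the set of measurable $u:\mathbb R^N\to\mathbb R$ with $\|u\|_{X_i}<\infty$, functions equal a.e. being identified. Then, for $i=1,2$,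 $X_i$ is a real vector space, $\|\cdot\|_{X_i}$ is a norm on $X_i$, and $(X_i,\|\cdot\|_{X_i})$ is a reflexive Banach space. -/

import Mathlib

open MeasureTheory
open scoped ENNReal

namespace FracMusielak

noncomputable section

/-- Euclidean space `ℝ^N`. -/
abbrev E (N : ℕ) : Type := EuclideanSpace ℝ (Fin N)

/-- `φ_{x,y}(t) = a(x,y,|t|) t` for `t ≠ 0`, and `φ_{x,y}(0) = 0`. -/
def phi {N : ℕ} (a : E N → E N → ℝ → ℝ) (x y : E N) (t : ℝ) : ℝ :=
  if t = 0 then 0 else a x y |t| * t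

/-- `Φ_{x,y}(t) = ∫_0^t φ_{x,y}(τ) dτ`, used for `t ≥ 0`. -/
def Phi {N : ℕ} (a : E N → E N → ℝ → ℝ) (x y : E N) (t : ℝ) : ℝ :=
  ∫ τ in (0 : ℝ)..t, phi a x y τ

/-- `Φ̂_x = Φ_{x,x}`. -/
def PhiHat {N : ℕ} (a : E N → E N → ℝ → ℝ) (x : E N) (t : ℝ) : ℝ :=
  Phi a x x t

/-- A variable fractional order: a continuous symmetric function `s` on `ℝ^N × ℝ^N` with
`0 < inf s ≤ sup s < 1`. -/
structure IsVariableOrder {N : ℕ} (s : E N → E N → ℝ) : Prop where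
  continuous : Continuous fun p : E N × E N => s p.1 p.2
  symm : ∀ x y, s x y = s y x
  bounds : ∃ sMin sMax : ℝ, 0 < sMin ∧ sMax < 1 ∧ ∀ x y, sMin ≤ s x y ∧ s x y ≤ sMax

/-- The standing assumptions on the function `a` which generates `φ` and `Φ`. -/
structure IsAdmissible {N : ℕ} (a : E N → E N → ℝ → ℝ) : Prop where
  symm : ∀ x y t, a x y t = a y x t
  /-- Lebesgue measurability in the space variables. -/
  measurable : ∀ t : ℝ, 0 < t → AEMeasurable (fun p : E N × E N => a p.1 p.2 t) volume
  /-- Lebesgue measurability of `x ↦ a(x,x,t)`; the diagonal of `ℝ^N × ℝ^N` is a null set. -/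
  measurable_diag : ∀ t : ℝ, 0 < t → AEMeasurable (fun x : E N => a x x t) volume
  /-- `φ_{x,y}` is an increasing homeomorphism of `ℝ` onto itself. -/
  isHomeomorph : ∀ x y, IsHomeomorph (phi a x y)
  strictMono : ∀ x y, StrictMono (phi a x y)
  /-- `1 < φ⁻ ≤ t φ_{x,y}(t) / Φ_{x,y}(t) ≤ φ⁺ < ∞`. -/
  growth : ∃ pMin pMax : ℝ, 1 < pMin ∧ ∀ x y, ∀ t : ℝ, 0 < t →
    pMin ≤ t * phi a x y t / Phi a x y t ∧ t * phi a x y t / Phi a x y t ≤ pMax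
  /-- `t ↦ Φ_{x,y}(√t)` is convex on `[0,∞)`. -/
  convex_sqrt : ∀ x y, ConvexOn ℝ (Set.Ici 0) fun t : ℝ => Phi a x y (√t)

/-- The Gagliardo seminorm: the infimum in `[0,∞]` of the `l > 0` such that the integral over
`ℝ^{2N} \ (CΩ)²` of `Φ_{x,y}(|u(x) - u(y)| / (l |x-y|^{s(x,y)})) dx dy / |x-y|^N` is at most `1`. -/
def gagliardo {N : ℕ} (s : E N → E N → ℝ) (a : E N → E N → ℝ → ℝ) (Ω : Set (E N))
    (u : E N → ℝ) : ℝ≥0∞ :=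
  ⨅ (l : ℝ) (_ : 0 < l) (_ : ∫⁻ p : E N × E N in (Ωᶜ ×ˢ Ωᶜ)ᶜ,
      ENNReal.ofReal (Phi a p.1 p.2 (|u p.1 - u p.2| / (l * ‖p.1 - p.2‖ ^ s p.1 p.2))
        / ‖p.1 - p.2‖ ^ N) ≤ 1),
    ENNReal.ofReal l

/-- The Luxemburg norm on `Ω`. -/
def luxemburg {N : ℕ} (a : E N → E N → ℝ → ℝ) (Ω : Set (E N)) (u : E N → ℝ) : ℝ≥0∞ :=
  ⨅ (l : ℝ) (_ : 0 < l) (_ : ∫⁻ x in Ω, ENNReal.ofReal (PhiHat a x (|u x| / l)) ≤ 1),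
    ENNReal.ofReal l

/-- The `β`-weighted Luxemburg norm on the complement of `Ω`. -/
def luxemburgCompl {N : ℕ} (a : E N → E N → ℝ → ℝ) (β : E N → ℝ) (Ω : Set (E N))
    (u : E N → ℝ) : ℝ≥0∞ :=
  ⨅ (l : ℝ) (_ : 0 < l)
    (_ : ∫⁻ x in Ωᶜ, ENNReal.ofReal (β x * PhiHat a x (|u x| / l)) ≤ 1),
    ENNReal.ofReal l

/-- `‖u‖_X ∈ [0,∞]` for a measurable `u : ℝ^N → ℝ`. -/
def normX {N : ℕ} (s : E N → E N → ℝ) (a : E N → E N → ℝ → ℝ) (β : E N → ℝ) (Ω : Set (E N))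
    (u : E N → ℝ) : ℝ≥0∞ :=
  gagliardo s a Ω u + luxemburg a Ω u + luxemburgCompl a β Ω u

/-- The space `X` of (a.e. classes of) measurable functions `u : ℝ^N → ℝ` with `‖u‖_X < ∞`. -/
def X {N : ℕ} (s : E N → E N → ℝ) (a : E N → E N → ℝ → ℝ) (β : E N → ℝ) (Ω : Set (E N)) :
    Set (E N →ₘ[volume] ℝ) :=
  {u | normX s a β Ω u < ∞}

/-- The function `n` is a norm on the real vector space `V`, and `(V, n)` is complete and
reflexive, that is, the canonical map of `V` into its bidual is onto. -/
def IsReflexiveBanachNorm {V : Type*} [AddCommGroup V] [Module ℝ V] (n : V → ℝ) : Prop :=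
  letI : Norm V := ⟨n⟩
  ∃ core : NormedSpace.Core ℝ V,
    letI : NormedAddCommGroup V := NormedAddCommGroup.ofCore core
    letI : NormedSpace ℝ V := NormedSpace.ofCore core
    CompleteSpace V ∧ Function.Surjective (NormedSpace.inclusionInDoubleDual ℝ V)

end

end FracMusielak

/-! Reflexivity comes from a Milman–Pettis argument run on a modular instead of the norm. Convexity
of `t ↦ Φ(√t)` together with `Φ(0) = 0` makes this function superadditive. The parallelogram
identity then gives Clarkson's inequality `Φ((s+t)/2) + Φ((s-t)/2) ≤ (Φ(s) + Φ(t))/2`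
(`Phi_clarkson`). The upper growth bound gives `Φ(2t) ≤ K Φ(t)` uniformly in the space variables
(`exists_Phi_two_mul_le`), so modular and Luxemburg functional control each other. Both properties
survive integration and addition, hence hold for the sum of the three modulars belonging to the
three terms of the norm. `inclusionInDoubleDual_surjective_of_clarkson` turns them into reflexivity.

For completeness and definiteness, a rapidly Cauchy sequence must converge a.e. on the whole space
(`ae_cauchySeq_of_ae_sub`). The `Ω`-term gives convergence a.e. on `Ω`, and the Gagliardo term gives
convergence of the differences `u_k(x) - u_k(y)` for a.e. pair meeting `Ω`. Fubini picks one good `x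
∈ Ω` from which convergence spreads to a.e. `y`. Fatou's lemma (`lux_le_of_tendsto`) upgrades this
to convergence in norm. -/

namespace FracMusielak

open Filter Topology NormedSpace

/-! ### Reflexivity from a modular with Clarkson's inequality -/

section Reflexive

variable {V : Type*} [NormedAddCommGroup V] [NormedSpace ℝ V]

/-- Helly's lemma: finitely many values of an element of the bidual are approximated by the values
of an element of the ball of the same radius. -/
theorem exists_norm_le_forall_abs_sub_lt_one (F : StrongDual ℝ (StrongDual ℝ V))
    (S : Finset (StrongDual ℝ V)) :
    ∃ x : V, ‖x‖ ≤ ‖F‖ ∧ ∀ f ∈ S, |f x - F f| < 1 := by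
  classical
  let T : V →L[ℝ] (S → ℝ) := ContinuousLinearMap.pi fun f : S => f.1
  let c : S → ℝ := fun f => F f.1
  by_cases hc : c ∈ closure (T '' Metric.closedBall 0 ‖F‖)
  · rw [Metric.mem_closure_iff] at hc
    obtain ⟨_, ⟨x, hx, rfl⟩, hd⟩ := hc 1 one_pos
    refine ⟨x, by simpa using hx, fun f hf => ?_⟩
    have h1 := (dist_le_pi_dist c (T x) ⟨f, hf⟩).trans_lt hd
    rw [dist_comm, Real.dist_eq] at h1
    exact h1
  · exfalso
    obtain ⟨g, u, hg, hu⟩ := geometric_hahn_banach_closed_point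
      (((convex_closedBall (0 : V) ‖F‖).linear_image T.toLinearMap).closure) isClosed_closure hc
    -- The separating functional on `ℝ^S`, composed with `T`, is a combination `h` of the given
    -- functionals. It stays below `u` on the ball of radius `‖F‖`, so `‖F‖ ‖h‖ ≤ u`, while `F h >
    -- u`.
    let h : StrongDual ℝ V := ∑ f : S, g (Pi.single f 1) • f.1
    have hgy : ∀ y : S → ℝ, g y = ∑ f : S, g (Pi.single f 1) * y f := by
      intro y
      conv_lhs => rw [pi_eq_sum_univ' y, map_sum]
      refine Finset.sum_congr rfl fun f _ => ?_
      rw [map_smul, smul_eq_mul, mul_comm]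
    have hgT : ∀ x, ‖x‖ ≤ ‖F‖ → h x < u := by
      intro x hx
      have := hg (T x) (subset_closure ⟨x, by simpa using hx, rfl⟩)
      rw [hgy] at this
      simpa [h, T] using this
    have hgc : u < F h := by
      rw [hgy] at hu
      simpa [h, c, map_sum] using hu
    have h0 : 0 < u := by simpa using hgT 0 (norm_zero.trans_le (norm_nonneg F))
    have hF : 0 < ‖F‖ := by
      rcases (norm_nonneg F).eq_or_lt with h1 | h1
      · have h2 : F h ≤ ‖F‖ * ‖h‖ := (le_abs_self _).trans (F.le_opNorm h)
        rw [← h1, zero_mul] at h2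
        linarith
      · exact h1
    have hh : ‖h‖ ≤ u / ‖F‖ := by
      refine ContinuousLinearMap.opNorm_le_bound _ (by positivity) fun x => ?_
      rcases eq_or_ne x 0 with rfl | hx
      · simp
      have hx' : 0 < ‖x‖ := norm_pos_iff.2 hx
      have key : ∀ e : ℝ, |e| = 1 → e * h x ≤ u / ‖F‖ * ‖x‖ := by
        intro e he
        have := hgT ((e * (‖F‖ / ‖x‖)) • x) (by
          rw [norm_smul, norm_mul, Real.norm_eq_abs e, he]
          simp [hx'.ne', abs_of_nonneg (norm_nonneg F)])
        rw [map_smul, smul_eq_mul] at this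
        rw [div_mul_eq_mul_div, le_div_iff₀ hF]
        have h2 : e * (‖F‖ / ‖x‖) * h x * ‖x‖ ≤ u * ‖x‖ :=
          mul_le_mul_of_nonneg_right this.le hx'.le
        have h3 : e * (‖F‖ / ‖x‖) * h x * ‖x‖ = e * h x * ‖F‖ := by field_simp
        linarith
      rw [Real.norm_eq_abs, abs_le]
      have k1 := key 1 (by simp)
      have k2 := key (-1) (by simp)
      constructor <;> linarith
    have h1 : F h ≤ ‖F‖ * ‖h‖ := (le_abs_self _).trans (F.le_opNorm h)
    have h2 : ‖F‖ * ‖h‖ ≤ u := by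
      rw [le_div_iff₀ hF] at hh
      linarith
    linarith

/-- A Milman–Pettis type theorem: a Banach space that carries a modular which controls the norm,
is bounded on balls and satisfies Clarkson's inequality, is reflexive. -/
theorem inclusionInDoubleDual_surjective_of_clarkson [CompleteSpace V] (ρ : V → ℝ)
    (hρ0 : ∀ u, 0 ≤ ρ u)
    (hbdd : ∀ R : ℝ, ∃ M, ∀ u, ‖u‖ ≤ R → ρ u ≤ M)
    (hsmall : ∀ ε : ℝ, 0 < ε → ∃ δ : ℝ, 0 < δ ∧ ∀ u, ρ u ≤ δ → ‖u‖ ≤ ε)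
    (hcl : ∀ u v, ρ ((1 / 2 : ℝ) • (u + v)) + ρ ((1 / 2 : ℝ) • (u - v)) ≤ (ρ u + ρ v) / 2) :
    Function.Surjective (inclusionInDoubleDual ℝ V) := by
  classical
  intro F
  -- Since functionals can be rescaled, `P R` says that `F` is a weak-star limit of points of the
  -- sublevel set `ρ ≤ R`. The threshold `r` below is the infimum of such levels.
  let P : ℝ → Prop := fun R => ∀ S : Finset (StrongDual ℝ V),
    ∃ x, ρ x ≤ R ∧ ∀ f ∈ S, |f x - F f| < 1
  have hPne : ∃ M, P M := by
    obtain ⟨M, hM⟩ := hbdd ‖F‖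
    refine ⟨M, fun S => ?_⟩
    obtain ⟨x, hx, hS⟩ := exists_norm_le_forall_abs_sub_lt_one F S
    exact ⟨x, hM x hx, hS⟩
  have hPbdd : BddBelow {R | P R} := by
    refine ⟨0, fun R hR => ?_⟩
    obtain ⟨x, hx, -⟩ := hR ∅
    exact (hρ0 x).trans hx
  set r := sInf {R | P R} with hr
  let η : ℕ → ℝ := fun n => 1 / ((n : ℝ) + 1)
  have hη : ∀ n, 0 < η n := fun n => Nat.one_div_pos_of_nat
  have hηanti : ∀ m n, n ≤ m → η m ≤ η n := fun m n h => Nat.one_div_le_one_div h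
  have hηlim : Tendsto η atTop (𝓝 0) := tendsto_one_div_add_atTop_nhds_zero_nat
  have hup : ∀ n, P (r + η n) := by
    intro n S
    obtain ⟨R, hR, hlt⟩ := exists_lt_of_csInf_lt hPne (lt_add_of_pos_right r (hη n))
    obtain ⟨x, hx, hS⟩ := hR S
    exact ⟨x, hx.trans hlt.le, hS⟩
  have hlow : ∀ n, ∃ S : Finset (StrongDual ℝ V),
      ∀ x, (∀ f ∈ S, |f x - F f| < 1) → r - η n < ρ x := by
    intro n
    by_contra! hcon
    have hP : P (r - η n) := fun S => by
      obtain ⟨x, hx, hS⟩ := hcon S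
      exact ⟨x, hS, hx⟩
    have := csInf_le hPbdd hP
    linarith [hη n]
  choose S hS using hlow
  -- The sets `S k` force `ρ` of any point satisfying them above `r - η k`. The extra functional `g`
  -- makes it possible to identify the limit at `g`; testing `(n + 1) • g` within 1 tests `g` within
  -- `η n`.
  let Q : ℕ → StrongDual ℝ V → V → Prop := fun n g x =>
    ρ x ≤ r + η n ∧ (∀ k ≤ n, ∀ f ∈ S k, |f x - F f| < 1) ∧ |g x - F g| < η n
  have hQ : ∀ n g, ∃ x, Q n g x := by
    intro n g
    obtain ⟨x, hx, hxS⟩ := hup n (insert (((n : ℝ) + 1) • g) ((Finset.range (n + 1)).biUnion S))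
    refine ⟨x, hx, fun k hk f hf => hxS f ?_, ?_⟩
    · exact Finset.mem_insert_of_mem
        (Finset.mem_biUnion.2 ⟨k, Finset.mem_range.2 (Nat.lt_succ_of_le hk), hf⟩)
    · have h1 := hxS _ (Finset.mem_insert_self _ _)
      have hn : (0 : ℝ) < (n : ℝ) + 1 := by positivity
      rw [map_smul, smul_apply, smul_eq_mul, smul_eq_mul, ← mul_sub, abs_mul,
        abs_of_pos hn] at h1
      rw [lt_div_iff₀ hn]
      linarith
  have hclose : ∀ n m g g' x y, n ≤ m → Q m g x → Q n g' y →
      ρ ((1 / 2 : ℝ) • (x - y)) ≤ 2 * η n := by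
    rintro n m g g' x y hnm ⟨hx, hxS, -⟩ ⟨hy, hyS, -⟩
    -- The constraints from `S n` are convex, so the midpoint inherits them and its modular is
    -- nearly at least `r`. Clarkson's inequality leaves only `O(η n)` for the half-difference.
    have hmid : r - η n < ρ ((1 / 2 : ℝ) • (x + y)) := by
      refine hS n _ fun f hf => ?_
      have h1 := abs_lt.1 (hxS n hnm f hf)
      have h2 := abs_lt.1 (hyS n le_rfl f hf)
      rw [map_smul, map_add, smul_eq_mul, abs_lt]
      constructor <;> linarith [h1.1, h1.2, h2.1, h2.2]
    have := hcl x y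
    have := hηanti m n hnm
    linarith
  have hnorm : ∀ ε : ℝ, 0 < ε → ∃ n₀ : ℕ, ∀ n ≥ n₀, ∀ m ≥ n, ∀ g g' x y, Q m g x → Q n g' y →
      ‖x - y‖ < ε := by
    intro ε hε
    obtain ⟨δ, hδ, hsm⟩ := hsmall (ε / 4) (by positivity)
    obtain ⟨n₀, hn₀⟩ := eventually_atTop.1 (hηlim.eventually (gt_mem_nhds (half_pos hδ)))
    refine ⟨n₀, fun n hn m hm g g' x y hx hy => ?_⟩
    have h1 := hsm _ ((hclose n m g g' x y hm hx hy).trans (by linarith [hn₀ n hn]))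
    rw [norm_smul] at h1
    norm_num at h1
    linarith
  choose z hz using hQ
  have hcau : CauchySeq fun n => z n 0 := by
    rw [Metric.cauchySeq_iff']
    intro ε hε
    obtain ⟨n₀, hn₀⟩ := hnorm ε hε
    refine ⟨n₀, fun n hn => ?_⟩
    rw [dist_eq_norm]
    exact hn₀ n₀ le_rfl n hn _ _ _ _ (hz n 0) (hz n₀ 0)
  obtain ⟨x, hx⟩ := cauchySeq_tendsto_of_complete hcau
  refine ⟨x, ContinuousLinearMap.ext fun g => ?_⟩
  -- The estimate in `hnorm` does not depend on the test functionals, so the sequences for different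
  -- `g` share one limit.
  have hd : Tendsto (fun n => z n g - z n 0) atTop (𝓝 0) := by
    rw [Metric.tendsto_atTop]
    intro ε hε
    obtain ⟨n₀, hn₀⟩ := hnorm ε hε
    refine ⟨n₀, fun n hn => ?_⟩
    rw [dist_zero_right]
    exact hn₀ n hn n le_rfl _ _ _ _ (hz n g) (hz n 0)
  have hzg : Tendsto (fun n => z n g) atTop (𝓝 x) := by
    simpa using hd.add hx
  have h1 : Tendsto (fun n => g (z n g)) atTop (𝓝 (g x)) := (g.continuous.tendsto x).comp hzg
  have h2 : Tendsto (fun n => g (z n g)) atTop (𝓝 (F g)) := by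
    rw [tendsto_iff_dist_tendsto_zero]
    exact squeeze_zero (fun _ => dist_nonneg) (fun n => (hz n g).2.2.le) hηlim
  exact tendsto_nhds_unique h1 h2

end Reflexive

/-- A criterion for a function on a real vector space to be a reflexive Banach norm. -/
theorem isReflexiveBanachNorm_of_clarkson {V : Type*} [AddCommGroup V] [Module ℝ V]
    (n ρ : V → ℝ) (hn0 : ∀ u, 0 ≤ n u) (hsmul : ∀ (c : ℝ) u, n (c • u) = |c| * n u)
    (hadd : ∀ u v, n (u + v) ≤ n u + n v) (hdef : ∀ u, n u = 0 → u = 0)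
    (hcomplete : ∀ u : ℕ → V, (∀ k, ∀ i ≥ k, ∀ j ≥ k, n (u i - u j) ≤ (1 / 4) ^ k) →
      ∃ v, Tendsto (fun k => n (u k - v)) atTop (𝓝 0))
    (hρ0 : ∀ u, 0 ≤ ρ u)
    (hbdd : ∀ R : ℝ, ∃ M, ∀ u, n u ≤ R → ρ u ≤ M)
    (hsmall : ∀ ε : ℝ, 0 < ε → ∃ δ : ℝ, 0 < δ ∧ ∀ u, ρ u ≤ δ → n u ≤ ε)
    (hcl : ∀ u v, ρ ((1 / 2 : ℝ) • (u + v)) + ρ ((1 / 2 : ℝ) • (u - v)) ≤ (ρ u + ρ v) / 2) :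
    IsReflexiveBanachNorm n := by
  let _ : Norm V := ⟨n⟩
  have core : NormedSpace.Core ℝ V :=
    { norm_nonneg := hn0
      norm_smul := hsmul
      norm_triangle := hadd
      norm_eq_zero_iff := fun u => ⟨hdef u, fun h => by
        have h0 : n 0 = 0 := by simpa only [zero_smul, abs_zero, zero_mul] using hsmul 0 0
        exact h ▸ h0⟩ }
  refine ⟨core, ?_⟩
  let _ : NormedAddCommGroup V := NormedAddCommGroup.ofCore core
  let _ : NormedSpace ℝ V := NormedSpace.ofCore core
  have hc : CompleteSpace V := by
    refine Metric.complete_of_convergent_controlled_sequences (fun k => (1 / 4 : ℝ) ^ k)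
      (fun k => by positivity) fun u hu => ?_
    obtain ⟨v, hv⟩ := hcomplete u fun k i hi j hj => by
      have := (hu k i j hi hj).le
      rwa [dist_eq_norm] at this
    refine ⟨v, ?_⟩
    rw [tendsto_iff_norm_sub_tendsto_zero]
    exact hv
  exact ⟨hc, inclusionInDoubleDual_surjective_of_clarkson ρ hρ0 hbdd hsmall hcl⟩

/-! ### Young functions of one variable -/

/-- An even convex function vanishing at the origin which is doubling with constant `K` and
satisfies Clarkson's inequality. -/
structure IsYoung (K : ℝ) (ψ : ℝ → ℝ) : Prop where
  zero : ψ 0 = 0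
  even : ∀ t, ψ (-t) = ψ t
  convex : ConvexOn ℝ Set.univ ψ
  doubling : ∀ t, ψ (2 * t) ≤ K * ψ t
  clarkson : ∀ s t, ψ ((s + t) / 2) + ψ ((s - t) / 2) ≤ (ψ s + ψ t) / 2

namespace IsYoung

variable {K : ℝ} {ψ : ℝ → ℝ}

theorem nonneg (h : IsYoung K ψ) (t : ℝ) : 0 ≤ ψ t := by
  have := h.convex.2 (Set.mem_univ t) (Set.mem_univ (-t)) (by norm_num : (0 : ℝ) ≤ 1 / 2)
    (by norm_num : (0 : ℝ) ≤ 1 / 2) (by norm_num)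
  simp only [smul_eq_mul, h.even] at this
  rw [show 1 / 2 * t + 1 / 2 * -t = 0 by ring, h.zero] at this
  linarith

theorem continuous (h : IsYoung K ψ) : Continuous ψ :=
  continuousOn_univ.1 (h.convex.continuousOn isOpen_univ)

theorem mul_le (h : IsYoung K ψ) {c : ℝ} (hc : 0 ≤ c) (hc1 : c ≤ 1) (t : ℝ) :
    ψ (c * t) ≤ c * ψ t := by
  have := h.convex.2 (Set.mem_univ t) (Set.mem_univ 0) hc (sub_nonneg.2 hc1) (by ring)
  simpa [h.zero] using this

theorem abs (h : IsYoung K ψ) (t : ℝ) : ψ |t| = ψ t := by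
  rcases abs_choice t with ht | ht <;> rw [ht]
  exact h.even t

theorem mono_of_abs_le (h : IsYoung K ψ) {s t : ℝ} (hst : |s| ≤ |t|) : ψ s ≤ ψ t := by
  rcases eq_or_ne t 0 with rfl | ht
  · rw [abs_zero, abs_nonpos_iff] at hst
    rw [hst]
  · have ht' : 0 < |t| := abs_pos.2 ht
    have := h.mul_le (by positivity : 0 ≤ |s| / |t|) ((div_le_one ht').2 hst) |t|
    rw [div_mul_cancel₀ _ ht'.ne', h.abs, h.abs] at this
    exact this.trans (mul_le_of_le_one_left (h.nonneg t) ((div_le_one ht').2 hst))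

theorem two_pow_mul_le (h : IsYoung K ψ) (hK : 0 ≤ K) (m : ℕ) (t : ℝ) :
    ψ (2 ^ m * t) ≤ K ^ m * ψ t := by
  induction m with
  | zero => simp
  | succ m ih =>
    calc ψ (2 ^ (m + 1) * t) = ψ (2 * (2 ^ m * t)) := by ring_nf
      _ ≤ K * ψ (2 ^ m * t) := h.doubling _
      _ ≤ K * (K ^ m * ψ t) := mul_le_mul_of_nonneg_left ih hK
      _ = K ^ (m + 1) * ψ t := by ring

/-- The weight `β` and the factor `|x-y|^{-N}` enter as `m`, the factor `|x-y|^{-s}` as `k`. The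
doubling constant is unaffected, hence uniform in the space variables. -/
theorem comp_mul (h : IsYoung K ψ) {m : ℝ} (hm : 0 ≤ m) (k : ℝ) :
    IsYoung K fun t => m * ψ (k * t) where
  zero := by simp [h.zero]
  even t := by rw [mul_neg, h.even]
  convex := by
    refine ⟨convex_univ, fun x _ y _ a b ha hb hab => ?_⟩
    have := h.convex.2 (Set.mem_univ (k * x)) (Set.mem_univ (k * y)) ha hb hab
    simp only [smul_eq_mul] at this ⊢
    rw [show k * (a * x + b * y) = a * (k * x) + b * (k * y) by ring]
    have := mul_le_mul_of_nonneg_left this hm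
    linarith
  doubling t := by
    have := mul_le_mul_of_nonneg_left (h.doubling (k * t)) hm
    rw [show k * (2 * t) = 2 * (k * t) by ring]
    linarith
  clarkson s t := by
    have := mul_le_mul_of_nonneg_left (h.clarkson (k * s) (k * t)) hm
    rw [show k * ((s + t) / 2) = (k * s + k * t) / 2 by ring,
      show k * ((s - t) / 2) = (k * s - k * t) / 2 by ring]
    linarith

end IsYoung

/-! ### Modulars and Luxemburg functionals -/

section Luxemburg

variable {α : Type*} [MeasurableSpace α]

/-- The modular `∫ ψ_x(f(x)) dμ(x)`. -/
noncomputable def modular (ψ : α → ℝ → ℝ) (μ : Measure α) (f : α → ℝ) : ℝ≥0∞ :=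
  ∫⁻ x, ENNReal.ofReal (ψ x (f x)) ∂μ

/-- The Luxemburg functional of a modular. -/
noncomputable def lux (ψ : α → ℝ → ℝ) (μ : Measure α) (f : α → ℝ) : ℝ≥0∞ :=
  ⨅ (l : ℝ) (_ : 0 < l) (_ : modular ψ μ (fun x => f x / l) ≤ 1), ENNReal.ofReal l

/-- A Musielak–Orlicz function whose sections are uniformly doubling Young functions. -/
structure IsMusielak (K : ℝ) (ψ : α → ℝ → ℝ) (μ : Measure α) : Prop where
  one_le : 1 ≤ K
  young : ∀ x, IsYoung K (ψ x)
  aemeasurable : ∀ f : α → ℝ, Measurable f → AEMeasurable (fun x => ψ x (f x)) μ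

variable {ψ : α → ℝ → ℝ} {μ : Measure α} {K : ℝ}

theorem modular_congr {f g : α → ℝ} (h : f =ᵐ[μ] g) : modular ψ μ f = modular ψ μ g :=
  lintegral_congr_ae (h.mono fun x hx => by simp only [hx])

theorem lux_congr {f g : α → ℝ} (h : f =ᵐ[μ] g) : lux ψ μ f = lux ψ μ g := by
  have : ∀ l : ℝ, modular ψ μ (fun x => f x / l) = modular ψ μ (fun x => g x / l) :=
    fun l => modular_congr (h.mono fun x hx => by simp only [hx])
  simp only [lux, this]

theorem lux_le_of_modular_le {f : α → ℝ} {l : ℝ} (hl : 0 < l)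
    (h : modular ψ μ (fun x => f x / l) ≤ 1) : lux ψ μ f ≤ ENNReal.ofReal l :=
  iInf_le_of_le l (iInf_le_of_le hl (iInf_le_of_le h le_rfl))

namespace IsMusielak

variable (h : IsMusielak K ψ μ)
include h

theorem modular_mul_le {c : ℝ} (hc : 0 ≤ c) (hc1 : c ≤ 1) (f : α → ℝ) :
    modular ψ μ (fun x => c * f x) ≤ ENNReal.ofReal c * modular ψ μ f := by
  rw [modular, modular, ← lintegral_const_mul' _ _ ENNReal.ofReal_ne_top]
  refine lintegral_mono fun x => ?_
  rw [← ENNReal.ofReal_mul hc]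
  exact ENNReal.ofReal_le_ofReal ((h.young x).mul_le hc hc1 _)

theorem modular_two_pow_mul_le (m : ℕ) (f : α → ℝ) :
    modular ψ μ (fun x => 2 ^ m * f x) ≤ ENNReal.ofReal (K ^ m) * modular ψ μ f := by
  have hK : 0 ≤ K := zero_le_one.trans h.one_le
  rw [modular, modular, ← lintegral_const_mul' _ _ ENNReal.ofReal_ne_top]
  refine lintegral_mono fun x => ?_
  rw [← ENNReal.ofReal_mul (pow_nonneg hK m)]
  exact ENNReal.ofReal_le_ofReal ((h.young x).two_pow_mul_le hK m _)

theorem modular_div_le_one_of_lux_lt {f : α → ℝ} {l : ℝ} (hlt : lux ψ μ f < ENNReal.ofReal l) :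
    modular ψ μ (fun x => f x / l) ≤ 1 := by
  simp only [lux, iInf_lt_iff] at hlt
  obtain ⟨k, hk, hmod, hkl⟩ := hlt
  have hkl' : k ≤ l := (ENNReal.ofReal_lt_ofReal_iff'.1 hkl).1.le
  refine le_trans (lintegral_mono fun x => ENNReal.ofReal_le_ofReal ?_) hmod
  refine (h.young x).mono_of_abs_le ?_
  rw [abs_div, abs_div, abs_of_pos hk, abs_of_pos (hk.trans_le hkl')]
  gcongr

theorem lux_add_le {f g : α → ℝ} (hf : Measurable f) :
    lux ψ μ (fun x => f x + g x) ≤ lux ψ μ f + lux ψ μ g := by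
  refine ENNReal.le_of_forall_pos_le_add fun ε hε hlt => ?_
  have hF : lux ψ μ f ≠ ∞ := (ENNReal.add_lt_top.1 hlt).1.ne
  have hG : lux ψ μ g ≠ ∞ := (ENNReal.add_lt_top.1 hlt).2.ne
  have hε' : (0 : ℝ) < ε := hε
  have key : ∀ w : α → ℝ, lux ψ μ w ≠ ∞ → modular ψ μ
      (fun x => w x / ((lux ψ μ w).toReal + ε / 2)) ≤ 1 := fun w hw =>
    h.modular_div_le_one_of_lux_lt
      ((ENNReal.lt_ofReal_iff_toReal_lt hw).2 (lt_add_of_pos_right _ (half_pos hε')))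
  set l := (lux ψ μ f).toReal + ε / 2 with hl
  set m := (lux ψ μ g).toReal + ε / 2 with hm
  have hl0 : 0 < l := by positivity
  have hm0 : 0 < m := by positivity
  -- `(f + g)/(l + m)` is the convex combination of `f/l` and `g/m` with weights `l/(l+m)` and
  -- `m/(l+m)`.
  have hmod : modular ψ μ (fun x => (f x + g x) / (l + m)) ≤ 1 := by
    calc modular ψ μ (fun x => (f x + g x) / (l + m))
        ≤ ∫⁻ x, (ENNReal.ofReal (l / (l + m)) * ENNReal.ofReal (ψ x (f x / l)) +
            ENNReal.ofReal (m / (l + m)) * ENNReal.ofReal (ψ x (g x / m))) ∂μ := by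
          refine lintegral_mono fun x => ?_
          have hy := h.young x
          rw [← ENNReal.ofReal_mul (by positivity), ← ENNReal.ofReal_mul (by positivity),
            ← ENNReal.ofReal_add (mul_nonneg (by positivity) (hy.nonneg _))
              (mul_nonneg (by positivity) (hy.nonneg _))]
          refine ENNReal.ofReal_le_ofReal ?_
          have := hy.convex.2 (Set.mem_univ (f x / l)) (Set.mem_univ (g x / m))
            (by positivity : 0 ≤ l / (l + m)) (by positivity : 0 ≤ m / (l + m)) (by field_simp)
          simp only [smul_eq_mul] at this
          rwa [show l / (l + m) * (f x / l) + m / (l + m) * (g x / m) = (f x + g x) / (l + m) by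
            field_simp] at this
      _ = ENNReal.ofReal (l / (l + m)) * modular ψ μ (fun x => f x / l) +
            ENNReal.ofReal (m / (l + m)) * modular ψ μ (fun x => g x / m) := by
          rw [lintegral_add_left', lintegral_const_mul' _ _ ENNReal.ofReal_ne_top,
            lintegral_const_mul' _ _ ENNReal.ofReal_ne_top, modular, modular]
          exact (h.aemeasurable _ (hf.div_const l)).ennreal_ofReal.const_mul _
      _ ≤ ENNReal.ofReal (l / (l + m)) * 1 + ENNReal.ofReal (m / (l + m)) * 1 := by
          gcongr
          · exact key f hF
          · exact key g hG
      _ = 1 := by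
          rw [mul_one, mul_one, ← ENNReal.ofReal_add (by positivity) (by positivity), ← add_div,
            div_self (by positivity), ENNReal.ofReal_one]
  refine (lux_le_of_modular_le (by positivity) hmod).trans_eq ?_
  rw [show l + m = (lux ψ μ f).toReal + (lux ψ μ g).toReal + ε by rw [hl, hm]; ring,
    ENNReal.ofReal_add (by positivity) hε'.le, ENNReal.ofReal_add (by positivity) (by positivity),
    ENNReal.ofReal_toReal hF, ENNReal.ofReal_toReal hG, ENNReal.ofReal_coe_nnreal]

theorem lux_zero : lux ψ μ (fun _ => 0) = 0 := by
  refine le_antisymm (ENNReal.le_of_forall_pos_le_add fun ε hε _ => ?_) zero_le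
  rw [zero_add, ← ENNReal.ofReal_coe_nnreal]
  refine lux_le_of_modular_le hε ?_
  simp [modular, (h.young _).zero]

theorem lux_mul_le {c : ℝ} (hc : c ≠ 0) (f : α → ℝ) :
    lux ψ μ (fun x => c * f x) ≤ ENNReal.ofReal |c| * lux ψ μ f := by
  have hc' : 0 < |c| := abs_pos.2 hc
  conv_rhs => rw [lux]
  simp only [ENNReal.mul_iInf_of_ne (ENNReal.ofReal_pos.2 hc').ne' ENNReal.ofReal_ne_top]
  refine le_iInf fun l => le_iInf fun hl => le_iInf fun hmod => ?_
  rw [← ENNReal.ofReal_mul hc'.le]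
  refine lux_le_of_modular_le (by positivity) (le_trans (le_of_eq ?_) hmod)
  refine lintegral_congr fun x => ?_
  rw [← (h.young x).abs, ← (h.young x).abs (f x / l), abs_div, abs_mul, abs_mul, abs_abs,
    mul_div_mul_left _ _ hc'.ne', abs_div]

theorem lux_mul (c : ℝ) (f : α → ℝ) :
    lux ψ μ (fun x => c * f x) = ENNReal.ofReal |c| * lux ψ μ f := by
  rcases eq_or_ne c 0 with rfl | hc
  · simp [h.lux_zero]
  refine le_antisymm (h.lux_mul_le hc f) ?_
  have hc' : 0 < |c| := abs_pos.2 hc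
  have := h.lux_mul_le (inv_ne_zero hc) fun x => c * f x
  simp only [inv_mul_cancel_left₀ hc] at this
  calc ENNReal.ofReal |c| * lux ψ μ f
      ≤ ENNReal.ofReal |c| * (ENNReal.ofReal |c⁻¹| * lux ψ μ fun x => c * f x) := by gcongr
    _ = lux ψ μ (fun x => c * f x) := by
        rw [← mul_assoc, ← ENNReal.ofReal_mul hc'.le, abs_inv, mul_inv_cancel₀ hc'.ne',
          ENNReal.ofReal_one, one_mul]

/-- Here `f / 2 ^ m` has modular at most 1, and undoing the scaling costs `m` doublings. -/
theorem modular_le_of_lux_lt {m : ℕ} {f : α → ℝ} (hf : lux ψ μ f < ENNReal.ofReal (2 ^ m)) :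
    modular ψ μ f ≤ ENNReal.ofReal (K ^ m) := by
  have h1 := h.modular_two_pow_mul_le m fun x => f x / 2 ^ m
  have h2 := h.modular_div_le_one_of_lux_lt hf
  simp only [mul_div_cancel₀ (b := (2 : ℝ) ^ m) _ (by positivity)] at h1
  exact h1.trans (mul_le_of_le_one_right zero_le h2)

theorem lux_le_of_modular_le_inv {m : ℕ} {f : α → ℝ}
    (hf : modular ψ μ f ≤ ENNReal.ofReal (K ^ m)⁻¹) : lux ψ μ f ≤ ENNReal.ofReal (2 ^ m)⁻¹ := by
  have hK : 0 < K ^ m := pow_pos (zero_lt_one.trans_le h.one_le) m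
  refine lux_le_of_modular_le (by positivity) ?_
  have h1 := h.modular_two_pow_mul_le m f
  simp only [div_inv_eq_mul, mul_comm _ ((2 : ℝ) ^ m)]
  refine h1.trans ?_
  calc ENNReal.ofReal (K ^ m) * modular ψ μ f
      ≤ ENNReal.ofReal (K ^ m) * ENNReal.ofReal (K ^ m)⁻¹ := by gcongr
    _ = 1 := by rw [← ENNReal.ofReal_mul hK.le, mul_inv_cancel₀ hK.ne', ENNReal.ofReal_one]

theorem modular_clarkson {f g : α → ℝ} (hf : Measurable f) (hg : Measurable g) :
    modular ψ μ (fun x => (f x + g x) / 2) + modular ψ μ (fun x => (f x - g x) / 2) ≤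
      (modular ψ μ f + modular ψ μ g) / 2 := by
  have h2 : (2 : ℝ≥0∞)⁻¹ = ENNReal.ofReal 2⁻¹ := by
    rw [ENNReal.ofReal_inv_of_pos two_pos, ENNReal.ofReal_ofNat]
  rw [div_eq_mul_inv, mul_comm, h2]
  simp only [modular]
  rw [← lintegral_add_left' (h.aemeasurable (fun x => (f x + g x) / 2)
      ((hf.add hg).div_const 2)).ennreal_ofReal,
    ← lintegral_add_left' (h.aemeasurable _ hf).ennreal_ofReal,
    ← lintegral_const_mul' _ _ ENNReal.ofReal_ne_top]
  refine lintegral_mono fun x => ?_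
  have hy := h.young x
  rw [← ENNReal.ofReal_add (hy.nonneg _) (hy.nonneg _),
    ← ENNReal.ofReal_add (hy.nonneg _) (hy.nonneg _), ← ENNReal.ofReal_mul (by norm_num)]
  refine ENNReal.ofReal_le_ofReal ?_
  have := hy.clarkson (f x) (g x)
  linarith

/-- Fatou's lemma for the modular at level `C + ε`; the slack is needed because a bound on the
infimum gives a modular bound only at strictly larger levels. -/
theorem lux_le_of_tendsto {g : ℕ → α → ℝ} {f : α → ℝ} (hg : ∀ k, Measurable (g k))
    (hlim : ∀ᵐ x ∂μ, Tendsto (fun k => g k x) atTop (𝓝 (f x))) {C : ℝ≥0∞}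
    (hC : ∀ᶠ k in atTop, lux ψ μ (g k) ≤ C) : lux ψ μ f ≤ C := by
  refine ENNReal.le_of_forall_pos_le_add fun ε hε hlt => ?_
  have hε' : (0 : ℝ) < ε := hε
  set l : ℝ := C.toReal + ε with hl
  have hl0 : 0 < l := by positivity
  have hCl : ENNReal.ofReal l = C + ε := by
    rw [hl, ENNReal.ofReal_add (by positivity) hε'.le, ENNReal.ofReal_toReal hlt.ne,
      ENNReal.ofReal_coe_nnreal]
  rw [← hCl]
  refine lux_le_of_modular_le hl0 ?_
  calc modular ψ μ (fun x => f x / l)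
      = ∫⁻ x, liminf (fun k => ENNReal.ofReal (ψ x (g k x / l))) atTop ∂μ := by
        refine lintegral_congr_ae (hlim.mono fun x hx => ?_)
        refine (Tendsto.liminf_eq ?_).symm
        exact (ENNReal.continuous_ofReal.tendsto _).comp
          (((h.young x).continuous.tendsto _).comp (hx.div_const l))
    _ ≤ liminf (fun k => ∫⁻ x, ENNReal.ofReal (ψ x (g k x / l)) ∂μ) atTop :=
        lintegral_liminf_le' fun k => (h.aemeasurable _ ((hg k).div_const l)).ennreal_ofReal
    _ ≤ 1 := by
        refine liminf_le_of_frequently_le' (Eventually.frequently (hC.mono fun k hk => ?_))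
        refine h.modular_div_le_one_of_lux_lt (hk.trans_lt ?_)
        rw [hCl]
        exact ENNReal.lt_add_right hlt.ne (by simpa using hε.ne')

/-- Positivity of `ψ x` is asked pointwise inside the conclusion because the Gagliardo density
vanishes on the diagonal. -/
theorem ae_cauchySeq {f : ℕ → α → ℝ} (hf : ∀ k, Measurable (f k))
    (hlux : ∀ k, lux ψ μ (fun x => f (k + 1) x - f k x) ≤ ENNReal.ofReal ((1 / 4) ^ k)) :
    ∀ᵐ x ∂μ, (∀ t, t ≠ 0 → 0 < ψ x t) → CauchySeq fun k => f k x := by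
  -- The increment divided by `2 * (1/4)^k` has modular at most 1. Half of the rate is spent here:
  -- convexity trades a factor `(1/2)^k` in the argument for a summable modular. The remaining `2^k`
  -- makes the increments themselves summable below.
  have hstep : ∀ k, modular ψ μ (fun x => 2 ^ k * (f (k + 1) x - f k x) / 2) ≤
      ENNReal.ofReal ((1 / 2) ^ k) := by
    intro k
    have hlt : lux ψ μ (fun x => f (k + 1) x - f k x) < ENNReal.ofReal (2 * (1 / 4) ^ k) := by
      have h4 : (0 : ℝ) < (1 / 4) ^ k := by positivity
      exact (hlux k).trans_lt ((ENNReal.ofReal_lt_ofReal_iff (by positivity)).2 (by linarith))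
    have h1 := h.modular_div_le_one_of_lux_lt hlt
    have h2 := h.modular_mul_le (by positivity : (0 : ℝ) ≤ (1 / 2) ^ k)
      (pow_le_one₀ (by norm_num) (by norm_num))
      (fun x => (f (k + 1) x - f k x) / (2 * (1 / 4) ^ k))
    have h3 : ∀ x, 2 ^ k * (f (k + 1) x - f k x) / 2 =
        (1 / 2) ^ k * ((f (k + 1) x - f k x) / (2 * (1 / 4) ^ k)) := by
      intro x
      have h4 : (4 : ℝ) ^ k = 2 ^ k * 2 ^ k := by rw [← mul_pow]; norm_num
      simp only [div_pow, one_pow, h4]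
      field_simp
    simp only [h3]
    exact h2.trans (mul_le_of_le_one_right zero_le h1)
  have hsum : ∑' k, modular ψ μ (fun x => 2 ^ k * (f (k + 1) x - f k x) / 2) ≠ ∞ := by
    refine ne_top_of_le_ne_top ?_ (ENNReal.tsum_le_tsum hstep)
    rw [← ENNReal.ofReal_tsum_of_nonneg (fun k => by positivity) summable_geometric_two]
    exact ENNReal.ofReal_ne_top
  have hmeas : ∀ k, AEMeasurable
      (fun x => ENNReal.ofReal (ψ x (2 ^ k * (f (k + 1) x - f k x) / 2))) μ := fun k =>
    (h.aemeasurable (fun x => 2 ^ k * (f (k + 1) x - f k x) / 2)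
      ((((hf (k + 1)).sub (hf k)).const_mul _).div_const 2)).ennreal_ofReal
  simp only [modular] at hsum
  rw [← lintegral_tsum hmeas] at hsum
  filter_upwards [ae_lt_top' (AEMeasurable.tsum hmeas) hsum] with x hx hpos
  have hy := h.young x
  have hlim := ENNReal.tendsto_atTop_zero_of_tsum_ne_top hx.ne
  -- Monotonicity in `|t|` turns `ψ x t < ψ x 1` into `|t| < 1`, so no inverse of `ψ x` is needed.
  have hev := hlim.eventually (gt_mem_nhds (ENNReal.ofReal_pos.2 (hpos 1 one_ne_zero)))
  have hbound : ∀ᶠ k in atTop, ‖dist (f k x) (f (k + 1) x)‖ ≤ 2 * (1 / 2 : ℝ) ^ k := by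
    filter_upwards [hev] with k hk
    have h1 : ψ x (2 ^ k * (f (k + 1) x - f k x) / 2) < ψ x 1 :=
      (ENNReal.ofReal_lt_ofReal_iff (hpos 1 one_ne_zero)).1 hk
    have h2 : |2 ^ k * (f (k + 1) x - f k x) / 2| < |1| := by
      by_contra hcon
      exact absurd (hy.mono_of_abs_le (not_lt.1 hcon)) (not_le.2 h1)
    rw [abs_one, abs_div, abs_mul, abs_two, abs_of_pos (by positivity : (0 : ℝ) < 2 ^ k),
      div_lt_one two_pos] at h2
    rw [Real.norm_of_nonneg dist_nonneg, dist_comm, Real.dist_eq, div_pow, one_pow, mul_one_div,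
      le_div_iff₀ (by positivity), mul_comm]
    exact h2.le
  exact cauchySeq_of_summable_dist
    (Summable.of_norm_bounded_eventually_nat (summable_geometric_two.mul_left 2) hbound)

end IsMusielak

end Luxemburg

/-! ### Seminorm–modular pairs and the abstract completeness argument -/

section ModularPair

open scoped NNReal

variable {β : Type*} [MeasurableSpace β] {ν : Measure β}

/-- An extended seminorm `n` with a modular `ρ` that controls it and satisfies Clarkson's
inequality, such that Cauchy sequences converging a.e. converge for `n`. -/
structure IsModularPair (n ρ : (β →ₘ[ν] ℝ) → ℝ≥0∞) : Prop where
  add_le : ∀ u v, n (u + v) ≤ n u + n v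
  smul : ∀ (c : ℝ) u, n (c • u) = ENNReal.ofReal |c| * n u
  bdd : ∀ R : ℝ≥0, ∃ M : ℝ≥0, ∀ u, n u ≤ R → ρ u ≤ M
  small : ∀ ε : ℝ≥0, 0 < ε → ∃ δ : ℝ≥0, 0 < δ ∧ ∀ u, ρ u ≤ δ → n u ≤ ε
  clarkson : ∀ u v, ρ ((1 / 2 : ℝ) • (u + v)) + ρ ((1 / 2 : ℝ) • (u - v)) ≤ (ρ u + ρ v) / 2
  closed : ∀ (u : ℕ → β →ₘ[ν] ℝ) (v : β →ₘ[ν] ℝ),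
    (∀ᵐ x ∂ν, Tendsto (fun k => u k x) atTop (𝓝 (v x))) →
    (∀ ε : ℝ≥0, 0 < ε → ∃ k₀, ∀ k ≥ k₀, ∀ j ≥ k, n (u j - u k) ≤ ε) →
    ∀ ε : ℝ≥0, 0 < ε → ∃ k₀, ∀ k ≥ k₀, n (v - u k) ≤ ε

namespace IsModularPair

variable {n ρ n' ρ' : (β →ₘ[ν] ℝ) → ℝ≥0∞}

/-- Every clause is additive, Clarkson's inequality included. Thus the sum of Luxemburg functionals
is handled with the sum of modulars, and no convexity inequality for the norm itself is needed. -/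
theorem add (h : IsModularPair n ρ) (h' : IsModularPair n' ρ') :
    IsModularPair (fun u => n u + n' u) (fun u => ρ u + ρ' u) where
  add_le u v := (add_le_add (h.add_le u v) (h'.add_le u v)).trans_eq (add_add_add_comm _ _ _ _)
  smul c u := by rw [h.smul, h'.smul, mul_add]
  bdd R := by
    obtain ⟨M, hM⟩ := h.bdd R
    obtain ⟨M', hM'⟩ := h'.bdd R
    refine ⟨M + M', fun u hu => ?_⟩
    rw [ENNReal.coe_add]
    exact add_le_add (hM u (le_self_add.trans hu)) (hM' u (le_add_self.trans hu))
  small ε hε := by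
    obtain ⟨δ, hδ, hs⟩ := h.small (ε / 2) (half_pos hε)
    obtain ⟨δ', hδ', hs'⟩ := h'.small (ε / 2) (half_pos hε)
    refine ⟨min δ δ', lt_min hδ hδ', fun u hu => ?_⟩
    rw [← add_halves ε, ENNReal.coe_add]
    exact add_le_add
      (hs u ((le_self_add.trans hu).trans (ENNReal.coe_le_coe.2 (min_le_left _ _))))
      (hs' u ((le_add_self.trans hu).trans (ENNReal.coe_le_coe.2 (min_le_right _ _))))
  clarkson u v := by
    calc _ = (ρ ((1 / 2 : ℝ) • (u + v)) + ρ ((1 / 2 : ℝ) • (u - v))) +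
          (ρ' ((1 / 2 : ℝ) • (u + v)) + ρ' ((1 / 2 : ℝ) • (u - v))) := add_add_add_comm _ _ _ _
      _ ≤ (ρ u + ρ v) / 2 + (ρ' u + ρ' v) / 2 := add_le_add (h.clarkson u v) (h'.clarkson u v)
      _ = _ := by rw [← ENNReal.add_div, add_add_add_comm]
  closed u v hlim hC ε hε := by
    obtain ⟨k₀, h₀⟩ := h.closed u v hlim (fun ε hε => (hC ε hε).imp fun k₀ hk k hk' j hj =>
      le_self_add.trans (hk k hk' j hj)) (ε / 2) (half_pos hε)
    obtain ⟨k₁, h₁⟩ := h'.closed u v hlim (fun ε hε => (hC ε hε).imp fun k₀ hk k hk' j hj =>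
      le_add_self.trans (hk k hk' j hj)) (ε / 2) (half_pos hε)
    refine ⟨max k₀ k₁, fun k hk => ?_⟩
    rw [← add_halves ε, ENNReal.coe_add]
    exact add_le_add (h₀ k ((le_max_left _ _).trans hk)) (h₁ k ((le_max_right _ _).trans hk))

/-- The finiteness domain of the seminorm of a modular pair. -/
def submodule (h : IsModularPair n ρ) : Submodule ℝ (β →ₘ[ν] ℝ) where
  carrier := {u | n u < ∞}
  add_mem' hu hv := (h.add_le _ _).trans_lt (ENNReal.add_lt_top.2 ⟨hu, hv⟩)
  zero_mem' := by
    have := h.smul 0 0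
    simp only [zero_smul, abs_zero, ENNReal.ofReal_zero, zero_mul] at this
    simp [this]
  smul_mem' c u hu := by
    rw [Set.mem_ofPred_eq, h.smul]
    exact ENNReal.mul_lt_top ENNReal.ofReal_lt_top hu

/-- The hypothesis `hconv` supplies what a seminorm lacks: it yields definiteness as well as the
a.e. limit used for completeness. -/
theorem isReflexiveBanachNorm (h : IsModularPair n ρ)
    (hconv : ∀ u : ℕ → β →ₘ[ν] ℝ, (∀ k, n (u (k + 1) - u k) ≤ ENNReal.ofReal ((1 / 4) ^ k)) →
      ∀ᵐ x ∂ν, CauchySeq fun k => u k x) :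
    IsReflexiveBanachNorm fun u : h.submodule => (n (u : β →ₘ[ν] ℝ)).toReal := by
  have hfin : ∀ u : h.submodule, n (u : β →ₘ[ν] ℝ) ≠ ∞ := fun u => ne_of_lt u.2
  have hρfin : ∀ u : h.submodule, ρ (u : β →ₘ[ν] ℝ) ≠ ∞ := by
    intro u
    obtain ⟨M, hM⟩ := h.bdd (n (u : β →ₘ[ν] ℝ)).toNNReal
    exact ne_top_of_le_ne_top ENNReal.coe_ne_top (hM u (ENNReal.coe_toNNReal (hfin u)).ge)
  refine isReflexiveBanachNorm_of_clarkson _ (fun u => (ρ (u : β →ₘ[ν] ℝ)).toReal)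
    (fun u => ENNReal.toReal_nonneg) (fun c u => ?_) (fun u v => ?_) (fun u hu => ?_)
    (fun u hu => ?_) (fun u => ENNReal.toReal_nonneg) (fun R => ?_) (fun ε hε => ?_)
    (fun u v => ?_)
  · simp [h.smul]
  · rw [← ENNReal.toReal_add (hfin u) (hfin v)]
    exact ENNReal.toReal_mono (ENNReal.add_ne_top.2 ⟨hfin u, hfin v⟩) (h.add_le _ _)
  · have hu0 : n (u : β →ₘ[ν] ℝ) = 0 := (ENNReal.toReal_eq_zero_iff _).1 hu |>.resolve_right (hfin u)
    -- Consecutive multiples of `u` differ by `u`, of seminorm zero, so `k * u(x)` converges for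
    -- a.e. `x`; this forces `u(x) = 0`.
    have hc := hconv (fun k => (k : ℝ) • (u : β →ₘ[ν] ℝ)) fun k => by
      rw [← sub_smul]
      push_cast
      rw [add_sub_cancel_left, one_smul, hu0]
      exact zero_le
    have hs : ∀ᵐ x ∂ν, ∀ k : ℕ, ((k : ℝ) • (u : β →ₘ[ν] ℝ) : β →ₘ[ν] ℝ) x =
        k * (u : β →ₘ[ν] ℝ) x :=
      ae_all_iff.2 fun k => AEEqFun.coeFn_smul _ _
    refine Subtype.ext (AEEqFun.ext ?_)
    filter_upwards [hc, hs, AEEqFun.coeFn_zero (β := ℝ) (μ := ν)] with x hx hsx h0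
    simp only [hsx] at hx
    obtain ⟨l, hl⟩ := cauchySeq_tendsto_of_complete hx
    have hd := ((tendsto_add_atTop_iff_nat 1).2 hl).sub hl
    have hcst : (fun k : ℕ => ((k + 1 : ℕ) : ℝ) * (u : β →ₘ[ν] ℝ) x - k * (u : β →ₘ[ν] ℝ) x) =
        fun _ => (u : β →ₘ[ν] ℝ) x := by
      funext k
      push_cast
      ring
    rw [hcst, sub_self] at hd
    rw [ZeroMemClass.coe_zero, h0]
    exact tendsto_nhds_unique tendsto_const_nhds hd
  · have hu' : ∀ k, ∀ i ≥ k, ∀ j ≥ k, n ((u i : β →ₘ[ν] ℝ) - u j) ≤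
        ENNReal.ofReal ((1 / 4) ^ k) := by
      intro k i hi j hj
      change n ((u i - u j : h.submodule) : β →ₘ[ν] ℝ) ≤ _
      rw [← ENNReal.ofReal_toReal (hfin (u i - u j))]
      exact ENNReal.ofReal_le_ofReal (hu k i hi j hj)
    have hc := hconv (fun k => u k) fun k => hu' k (k + 1) k.le_succ k le_rfl
    obtain ⟨g, hg, hlim⟩ := exists_stronglyMeasurable_limit_of_tendsto_ae
      (fun k => (u k : β →ₘ[ν] ℝ).aestronglyMeasurable)
      (hc.mono fun x hx => cauchySeq_tendsto_of_complete hx)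
    set v : β →ₘ[ν] ℝ := AEEqFun.mk g hg.aestronglyMeasurable with hv
    have hlim' : ∀ᵐ x ∂ν, Tendsto (fun k => (u k : β →ₘ[ν] ℝ) x) atTop (𝓝 (v x)) := by
      filter_upwards [hlim, AEEqFun.coeFn_mk g hg.aestronglyMeasurable] with x hx hx'
      rwa [hv, hx']
    have hgeom : Tendsto (fun k : ℕ => (1 / 4 : ℝ) ^ k) atTop (𝓝 0) :=
      tendsto_pow_atTop_nhds_zero_of_lt_one (by norm_num) (by norm_num)
    have hclosed := h.closed (fun k => u k) v hlim' fun ε hε => by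
      obtain ⟨k₀, hk₀⟩ := eventually_atTop.1
        (hgeom.eventually (gt_mem_nhds (NNReal.coe_pos.2 hε)))
      refine ⟨k₀, fun k hk j hj => (hu' k j hj k le_rfl).trans ?_⟩
      rw [← ENNReal.ofReal_coe_nnreal]
      exact ENNReal.ofReal_le_ofReal (hk₀ k hk).le
    have hvmem : n v < ∞ := by
      obtain ⟨k₀, hk₀⟩ := hclosed 1 one_pos
      have := h.add_le (v - u k₀) (u k₀)
      rw [sub_add_cancel] at this
      exact this.trans_lt (ENNReal.add_lt_top.2
        ⟨(hk₀ k₀ le_rfl).trans_lt ENNReal.coe_lt_top, (u k₀).2⟩)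
    refine ⟨⟨v, hvmem⟩, ?_⟩
    rw [Metric.tendsto_atTop]
    intro ε hε
    obtain ⟨k₀, hk₀⟩ := hclosed ⟨ε / 2, by positivity⟩ (half_pos hε)
    refine ⟨k₀, fun k hk => ?_⟩
    rw [dist_zero_right, Real.norm_of_nonneg ENNReal.toReal_nonneg]
    have hsymm : n ((u k : β →ₘ[ν] ℝ) - v) = n (v - u k) := by
      rw [← neg_sub, ← neg_one_smul ℝ, h.smul]
      simp
    change (n ((u k : β →ₘ[ν] ℝ) - v)).toReal < ε
    rw [hsymm]
    exact (ENNReal.toReal_mono ENNReal.coe_ne_top (hk₀ k hk)).trans_lt (half_lt_self hε)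
  · obtain ⟨M, hM⟩ := h.bdd R.toNNReal
    refine ⟨M, fun u hu => ENNReal.toReal_mono ENNReal.coe_ne_top (hM u ?_)⟩
    rw [← ENNReal.ofReal_toReal (hfin u)]
    exact ENNReal.ofReal_le_ofReal hu
  · obtain ⟨δ, hδ, hs⟩ := h.small ⟨ε, hε.le⟩ hε
    refine ⟨δ, hδ, fun u hu => ENNReal.toReal_mono ENNReal.coe_ne_top (hs u ?_)⟩
    rw [← ENNReal.ofReal_toReal (hρfin u), ← ENNReal.ofReal_coe_nnreal]
    exact ENNReal.ofReal_le_ofReal hu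
  · rw [← ENNReal.toReal_add (hρfin _) (hρfin _), ← ENNReal.toReal_add (hρfin _) (hρfin _),
      ← ENNReal.toReal_ofNat 2, ← ENNReal.toReal_div]
    exact ENNReal.toReal_mono
      (ENNReal.div_ne_top (ENNReal.add_ne_top.2 ⟨hρfin u, hρfin v⟩) two_ne_zero) (h.clarkson u v)

end IsModularPair

/-- The pullback of a Luxemburg functional under a linear map that preserves a.e. convergence. -/
theorem IsMusielak.isModularPair {α : Type*} [MeasurableSpace α] {ψ : α → ℝ → ℝ} {μ : Measure α}
    {K : ℝ} (h : IsMusielak K ψ μ) (T : (β →ₘ[ν] ℝ) → α → ℝ) (hT : ∀ u, Measurable (T u))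
    (hadd : ∀ u v, T (u + v) =ᵐ[μ] fun x => T u x + T v x)
    (hsmul : ∀ (c : ℝ) u, T (c • u) =ᵐ[μ] fun x => c * T u x)
    (hlim : ∀ (u : ℕ → β →ₘ[ν] ℝ) (v : β →ₘ[ν] ℝ),
      (∀ᵐ x ∂ν, Tendsto (fun k => u k x) atTop (𝓝 (v x))) →
      ∀ᵐ x ∂μ, Tendsto (fun k => T (u k) x) atTop (𝓝 (T v x))) :
    IsModularPair (fun u => lux ψ μ (T u)) fun u => modular ψ μ (T u) := by
  have hsub : ∀ u v, T (u - v) =ᵐ[μ] fun x => T u x - T v x := by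
    intro u v
    have h1 := hadd u ((-1 : ℝ) • v)
    rw [neg_one_smul, ← sub_eq_add_neg] at h1
    have h2 := hsmul (-1) v
    rw [neg_one_smul] at h2
    filter_upwards [h1, h2] with x hx hx'
    rw [hx, hx']
    ring
  constructor
  · intro u v
    rw [lux_congr (hadd u v)]
    exact h.lux_add_le (hT u)
  · intro c u
    rw [lux_congr (hsmul c u), h.lux_mul]
  · intro R
    obtain ⟨m, hm⟩ := pow_unbounded_of_one_lt (R : ℝ) (one_lt_two)
    refine ⟨(K ^ m).toNNReal, fun u hu => h.modular_le_of_lux_lt (hu.trans_lt ?_)⟩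
    rw [← ENNReal.ofReal_coe_nnreal]
    exact (ENNReal.ofReal_lt_ofReal_iff (by positivity)).2 hm
  · intro ε hε
    obtain ⟨m, hm⟩ := exists_pow_lt_of_lt_one (NNReal.coe_pos.2 hε)
      (by norm_num : (2 : ℝ)⁻¹ < 1)
    have hK : 0 < K ^ m := pow_pos (zero_lt_one.trans_le h.one_le) m
    refine ⟨((K ^ m)⁻¹).toNNReal, Real.toNNReal_pos.2 (inv_pos.2 hK), fun u hu =>
      (h.lux_le_of_modular_le_inv hu).trans ?_⟩
    rw [← ENNReal.ofReal_coe_nnreal, ← inv_pow]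
    exact ENNReal.ofReal_le_ofReal hm.le
  · intro u v
    have h1 : T ((1 / 2 : ℝ) • (u + v)) =ᵐ[μ] fun x => (T u x + T v x) / 2 := by
      filter_upwards [hsmul (1 / 2) (u + v), hadd u v] with x hx hx'
      rw [hx, hx']
      ring
    have h2 : T ((1 / 2 : ℝ) • (u - v)) =ᵐ[μ] fun x => (T u x - T v x) / 2 := by
      filter_upwards [hsmul (1 / 2) (u - v), hsub u v] with x hx hx'
      rw [hx, hx']
      ring
    rw [modular_congr h1, modular_congr h2]
    exact h.modular_clarkson (hT u) (hT v)
  · intro u v huv hC ε hε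
    obtain ⟨k₀, hk₀⟩ := hC ε hε
    refine ⟨k₀, fun k hk => ?_⟩
    rw [lux_congr (hsub v (u k))]
    -- Fatou is applied to `u j - u k` with `k` fixed and `j → ∞`.
    refine h.lux_le_of_tendsto (g := fun j x => T (u j) x - T (u k) x)
      (fun j => (hT (u j)).sub (hT (u k)))
      ((hlim u v huv).mono fun x hx => hx.sub_const _) ?_
    filter_upwards [eventually_ge_atTop k] with j hj
    rw [← lux_congr (hsub (u j) (u k))]
    exact hk₀ k hk j hj

end ModularPair

/-! ### Measurability of primitives -/

/-- The primitive of a Carathéodory function is a Carathéodory function. -/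
theorem aemeasurable_intervalIntegral_of_caratheodory {α : Type*} [MeasurableSpace α]
    {μ : Measure α} {φ : α → ℝ → ℝ} (hc : ∀ x, Continuous (φ x))
    (hm : ∀ t, AEMeasurable (fun x => φ x t) μ) {f : α → ℝ} (hf : Measurable f) :
    AEMeasurable (fun x => ∫ τ in (0 : ℝ)..f x, φ x τ) μ := by
  classical
  -- The exceptional null set depends on `t`. Restricting to rational `t` gives one null set for
  -- all; setting `φ` to zero there and using continuity in `t` gives honest measurability for every
  -- real `t`.
  have hall : ∀ᵐ x ∂μ, ∀ q : ℚ, φ x q = (hm q).mk _ x :=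
    ae_all_iff.2 fun q => (hm q).ae_eq_mk
  obtain ⟨t, hts, htm, ht0⟩ := exists_measurable_superset_of_null (ae_iff.1 hall)
  have hmem : ∀ x, x ∉ t → ∀ q : ℚ, φ x q = (hm q).mk _ x := fun x hx => by
    by_contra hcon
    exact hx (hts hcon)
  let φ' : ℝ → α → ℝ := fun τ x => if x ∈ t then 0 else φ x τ
  have hcont : ∀ x, Continuous fun τ => φ' τ x := by
    intro x
    by_cases hx : x ∈ t
    · simp only [φ', hx, if_true]
      exact continuous_const
    · simp only [φ', hx, if_false]
      exact hc x
  have hrat : ∀ q : ℚ, Measurable (φ' q) := by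
    intro q
    have : φ' q = fun x => if x ∈ t then 0 else (hm q).mk _ x := by
      funext x
      by_cases hx : x ∈ t
      · simp only [φ', hx, if_true]
      · simp only [φ', hx, if_false, hmem x hx q]
    rw [this]
    exact Measurable.ite htm measurable_const (hm q).measurable_mk
  have hreal : ∀ τ, Measurable (φ' τ) := by
    intro τ
    obtain ⟨q, hq, hlim⟩ := mem_closure_iff_seq_limit.1 (Rat.denseRange_cast (𝕜 := ℝ) τ)
    refine measurable_of_tendsto_metrizable (f := fun n => φ' (q n)) (fun n => ?_)
      (tendsto_pi_nhds.2 fun x => ((hcont x).tendsto τ).comp hlim)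
    obtain ⟨r, hr⟩ := hq n
    rw [← hr]
    exact hrat r
  have hjoint : Measurable (Function.uncurry φ') :=
    measurable_uncurry_of_continuous_of_measurable hcont hreal
  have hswap : StronglyMeasurable (Function.uncurry fun x τ => φ' τ x) :=
    (hjoint.comp measurable_swap).stronglyMeasurable
  have hprim : ∀ r : ℝ, Measurable fun x => ∫ τ in (0 : ℝ)..r, φ' τ x := fun r =>
    (hswap.integral_prod_right (ν := volume.restrict (Set.Ioc 0 r))).measurable.sub
      (hswap.integral_prod_right (ν := volume.restrict (Set.Ioc r 0))).measurable
  have hprimc : ∀ x, Continuous fun r : ℝ => ∫ τ in (0 : ℝ)..r, φ' τ x := fun x =>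
    intervalIntegral.continuous_primitive (fun a b => (hcont x).intervalIntegrable a b) 0
  have hmeas : Measurable fun x => ∫ τ in (0 : ℝ)..f x, φ' τ x :=
    (measurable_uncurry_of_continuous_of_measurable hprimc hprim).comp (hf.prodMk measurable_id)
  refine ⟨_, hmeas, ?_⟩
  have hnot : ∀ᵐ x ∂μ, x ∉ t := measure_eq_zero_iff_ae_notMem.1 ht0
  filter_upwards [hnot] with x hx
  simp only [φ', hx, if_false]

/-! ### Pointwise inequalities for `Φ` -/

variable {N : ℕ} {a : E N → E N → ℝ → ℝ}

theorem phi_zero (x y : E N) : phi a x y 0 = 0 := if_pos rfl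

theorem phi_neg (x y : E N) (t : ℝ) : phi a x y (-t) = -phi a x y t := by
  rcases eq_or_ne t 0 with rfl | ht
  · simp [phi_zero]
  · simp [phi, ht]

theorem Phi_zero (x y : E N) : Phi a x y 0 = 0 := intervalIntegral.integral_same

theorem Phi_neg (x y : E N) (t : ℝ) : Phi a x y (-t) = Phi a x y t := by
  have h := intervalIntegral.integral_comp_neg (a := 0) (b := t) (phi a x y)
  simp only [phi_neg, intervalIntegral.integral_neg, neg_zero] at h
  rw [Phi, intervalIntegral.integral_symm, ← h, neg_neg, Phi]

theorem Phi_abs (x y : E N) (t : ℝ) : Phi a x y |t| = Phi a x y t := by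
  rcases abs_choice t with ht | ht <;> rw [ht]
  exact Phi_neg x y t

namespace IsAdmissible

variable (ha : IsAdmissible a)
include ha

theorem hasDerivAt_Phi (x y : E N) (t : ℝ) : HasDerivAt (Phi a x y) (phi a x y t) t :=
  ((ha.isHomeomorph x y).continuous.integral_hasStrictDerivAt 0 t).hasDerivAt

theorem Phi_pos (x y : E N) {t : ℝ} (ht : t ≠ 0) : 0 < Phi a x y t := by
  rw [← Phi_abs]
  refine intervalIntegral.intervalIntegral_pos_of_pos_on
    ((ha.isHomeomorph x y).continuous.intervalIntegrable _ _) (fun τ hτ => ?_) (abs_pos.2 ht)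
  rw [← phi_zero (a := a) x y]
  exact ha.strictMono x y hτ.1

theorem convexOn_Phi (x y : E N) : ConvexOn ℝ Set.univ (Phi a x y) := by
  refine Monotone.convexOn_univ_of_deriv
    (fun t => (ha.hasDerivAt_Phi x y t).differentiableAt) ?_
  rw [funext fun t => (ha.hasDerivAt_Phi x y t).deriv]
  exact (ha.strictMono x y).monotone

theorem Phi_clarkson (x y : E N) (s t : ℝ) :
    Phi a x y ((s + t) / 2) + Phi a x y ((s - t) / 2) ≤ (Phi a x y s + Phi a x y t) / 2 := by
  have hG := ha.convex_sqrt x y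
  set G : ℝ → ℝ := fun r => Phi a x y (√r) with hGdef
  have hsq : ∀ r, G (r ^ 2) = Phi a x y r := fun r => by
    rw [hGdef]
    simp only
    rw [Real.sqrt_sq_eq_abs, Phi_abs]
  have hG0 : G 0 = 0 := by simp [hGdef, Phi_zero]
  have hsuper : ∀ p q, 0 ≤ p → 0 ≤ q → G p + G q ≤ G (p + q) := by
    intro p q hp hq
    rcases (add_nonneg hp hq).eq_or_lt with h0 | h0
    · obtain rfl : p = 0 := by linarith
      obtain rfl : q = 0 := by linarith
      simp [hG0]
    · have key : ∀ r, 0 ≤ r → r ≤ p + q → G r ≤ r / (p + q) * G (p + q) := by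
        intro r hr hrpq
        have := hG.2 (Set.mem_Ici.2 h0.le) (Set.mem_Ici.2 le_rfl)
          (by positivity : 0 ≤ r / (p + q)) (sub_nonneg.2 ((div_le_one h0).2 hrpq)) (by ring)
        simpa only [smul_eq_mul, mul_zero, add_zero, hG0, div_mul_cancel₀ _ h0.ne'] using this
      have h1 := key p hp (by linarith)
      have h2 := key q hq (by linarith)
      calc G p + G q ≤ p / (p + q) * G (p + q) + q / (p + q) * G (p + q) := add_le_add h1 h2
        _ = G (p + q) := by rw [← add_mul, ← add_div, div_self h0.ne', one_mul]
  -- The two squares add up to `(s² + t²)/2`, to which midpoint convexity of `G` applies.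
  have h1 := hsuper (((s + t) / 2) ^ 2) (((s - t) / 2) ^ 2) (sq_nonneg _) (sq_nonneg _)
  have h2 := hG.2 (Set.mem_Ici.2 (sq_nonneg s)) (Set.mem_Ici.2 (sq_nonneg t))
    (by norm_num : (0 : ℝ) ≤ 1 / 2) (by norm_num : (0 : ℝ) ≤ 1 / 2) (by norm_num)
  simp only [smul_eq_mul] at h2
  rw [show 1 / 2 * s ^ 2 + 1 / 2 * t ^ 2 = ((s + t) / 2) ^ 2 + ((s - t) / 2) ^ 2 by ring] at h2
  have h3 := h1.trans h2
  simp only [hsq] at h3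
  linarith

theorem exists_Phi_two_mul_le : ∃ K : ℝ, 1 ≤ K ∧ ∀ x y t, Phi a x y (2 * t) ≤ K * Phi a x y t := by
  obtain ⟨pMin, pMax, -, hp⟩ := ha.growth
  obtain ⟨n, hn⟩ := exists_nat_ge pMax
  refine ⟨2 ^ n, one_le_pow₀ one_le_two, fun x y => ?_⟩
  -- Rounding `pMax` up to `n` gives `t φ(t) ≤ n Φ(t)`, which says that `Φ(t) / t ^ n` has
  -- nonpositive derivative; comparing `t` with `2t` yields `K = 2 ^ n`.
  have hanti : AntitoneOn (fun t => Phi a x y t / t ^ n) (Set.Ioi 0) := by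
    have hd : ∀ t : ℝ, 0 < t → HasDerivAt (fun t => Phi a x y t / t ^ n)
        ((phi a x y t * t ^ n - Phi a x y t * (n * t ^ (n - 1))) / (t ^ n) ^ 2) t := fun t ht =>
      (ha.hasDerivAt_Phi x y t).fun_div (hasDerivAt_pow n t) (pow_pos ht n).ne'
    refine antitoneOn_of_deriv_nonpos (convex_Ioi 0)
      (fun t ht => (hd t ht).continuousAt.continuousWithinAt) ?_ ?_
    · rw [interior_Ioi]
      exact fun t ht => (hd t ht).differentiableAt.differentiableWithinAt
    · rw [interior_Ioi]
      intro t ht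
      have ht' : (0 : ℝ) < t := ht
      rw [(hd t ht).deriv]
      refine div_nonpos_of_nonpos_of_nonneg ?_ (by positivity)
      have hΦ := ha.Phi_pos x y ht'.ne'
      have h1 : t * phi a x y t ≤ n * Phi a x y t :=
        (div_le_iff₀ hΦ).1 (((hp x y t ht').2).trans hn)
      -- For `n = 0` the exponent `n - 1` truncates to 0, but the factor `n` vanishes.
      have h2 : (n : ℝ) * t ^ (n - 1) * t = n * t ^ n := by
        rcases n.eq_zero_or_pos with rfl | hn0
        · simp
        · rw [mul_assoc, pow_sub_one_mul hn0.ne']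
      have h3 : t * (phi a x y t * t ^ n - Phi a x y t * (n * t ^ (n - 1))) ≤ 0 := by
        have h4 := mul_le_mul_of_nonneg_right h1 (pow_pos ht' n).le
        have h5 : t * (phi a x y t * t ^ n - Phi a x y t * (n * t ^ (n - 1))) =
            t * phi a x y t * t ^ n - Phi a x y t * (n * t ^ (n - 1) * t) := by ring
        rw [h5, h2]
        linarith
      exact nonpos_of_mul_nonpos_right h3 ht'
  have hpos : ∀ t, 0 < t → Phi a x y (2 * t) ≤ 2 ^ n * Phi a x y t := by
    intro t ht
    have := hanti (Set.mem_Ioi.2 ht) (Set.mem_Ioi.2 (by positivity : 0 < 2 * t)) (by linarith)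
    simp only at this
    rw [div_le_div_iff₀ (by positivity) (by positivity), mul_pow] at this
    refine le_of_mul_le_mul_right ?_ (pow_pos ht n)
    linarith
  intro t
  rcases lt_trichotomy t 0 with ht | rfl | ht
  · have := hpos (-t) (neg_pos.2 ht)
    rwa [mul_neg, Phi_neg, Phi_neg] at this
  · simp [Phi_zero]
  · exact hpos t ht

theorem exists_isYoung : ∃ K : ℝ, 1 ≤ K ∧ ∀ x y, IsYoung K (Phi a x y) := by
  obtain ⟨K, hK, h⟩ := ha.exists_Phi_two_mul_le
  exact ⟨K, hK, fun x y => ⟨Phi_zero x y, Phi_neg x y, ha.convexOn_Phi x y, h x y,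
    ha.Phi_clarkson x y⟩⟩

theorem aemeasurable_Phi {f : E N × E N → ℝ} (hf : Measurable f) :
    AEMeasurable (fun p : E N × E N => Phi a p.1 p.2 (f p)) volume := by
  refine aemeasurable_intervalIntegral_of_caratheodory
    (φ := fun p : E N × E N => phi a p.1 p.2)
    (fun p => (ha.isHomeomorph p.1 p.2).continuous) (fun t => ?_) hf
  rcases eq_or_ne t 0 with rfl | ht
  · simp only [phi_zero]
    exact aemeasurable_const
  · simp only [phi, ht, if_false]
    exact (ha.measurable |t| (abs_pos.2 ht)).mul_const t

theorem aemeasurable_PhiHat {f : E N → ℝ} (hf : Measurable f) :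
    AEMeasurable (fun x : E N => PhiHat a x (f x)) volume := by
  refine aemeasurable_intervalIntegral_of_caratheodory (φ := fun x : E N => phi a x x)
    (fun x => (ha.isHomeomorph x x).continuous) (fun t => ?_) hf
  rcases eq_or_ne t 0 with rfl | ht
  · simp only [phi_zero]
    exact aemeasurable_const
  · simp only [phi, ht, if_false]
    exact (ha.measurable_diag |t| (abs_pos.2 ht)).mul_const t

end IsAdmissible

/-! ### The three terms of the norm as Luxemburg functionals -/

variable {s : E N → E N → ℝ} {Ω : Set (E N)} {β : E N → ℝ}

/-- The Musielak–Orlicz function on pairs of points that underlies the Gagliardo seminorm. -/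
noncomputable def gagliardoDensity (s : E N → E N → ℝ) (a : E N → E N → ℝ → ℝ)
    (p : E N × E N) (t : ℝ) : ℝ :=
  (‖p.1 - p.2‖ ^ N)⁻¹ * Phi a p.1 p.2 ((‖p.1 - p.2‖ ^ s p.1 p.2)⁻¹ * t)

/-- The `β`-weighted Musielak–Orlicz function on the complement. -/
noncomputable def weightedDensity (a : E N → E N → ℝ → ℝ) (β : E N → ℝ) (x : E N) (t : ℝ) : ℝ :=
  max (β x) 0 * PhiHat a x t

theorem gagliardo_eq_lux (u : E N → ℝ) : gagliardo s a Ω u =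
    lux (gagliardoDensity s a) (volume.restrict (Ωᶜ ×ˢ Ωᶜ)ᶜ) fun p => u p.1 - u p.2 := by
  have : ∀ l : ℝ, 0 < l → ∀ p : E N × E N,
      Phi a p.1 p.2 (|u p.1 - u p.2| / (l * ‖p.1 - p.2‖ ^ s p.1 p.2)) / ‖p.1 - p.2‖ ^ N =
      gagliardoDensity s a p ((u p.1 - u p.2) / l) := by
    intro l hl p
    rw [gagliardoDensity, div_eq_inv_mul (Phi _ _ _ _), ← Phi_abs _ _ (_ * _), abs_mul, abs_div,
      abs_of_pos hl, abs_of_nonneg (inv_nonneg.2 (Real.rpow_nonneg (norm_nonneg _) _)),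
      ← div_div, div_eq_inv_mul (_ / l)]
  refine iInf_congr fun l => iInf_congr fun hl => ?_
  simp only [modular, this l hl]

theorem luxemburg_eq_lux (u : E N → ℝ) :
    luxemburg a Ω u = lux (PhiHat a) (volume.restrict Ω) u := by
  have : ∀ l : ℝ, 0 < l → ∀ x, PhiHat a x (|u x| / l) = PhiHat a x (u x / l) := by
    intro l hl x
    rw [PhiHat, PhiHat, ← Phi_abs _ _ (u x / l), abs_div, abs_of_pos hl]
  refine iInf_congr fun l => iInf_congr fun hl => ?_
  simp only [modular, this l hl]

/-- `β` is nonnegative only a.e., whereas `IsMusielak` asks for Young functions at every point;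
`ENNReal.ofReal` discards the negative part, so `max (β x) 0` may replace `β x`. -/
theorem luxemburgCompl_eq_lux (hΦ : ∀ x t, 0 ≤ PhiHat a x t) (u : E N → ℝ) :
    luxemburgCompl a β Ω u = lux (weightedDensity a β) (volume.restrict Ωᶜ) u := by
  have : ∀ l : ℝ, 0 < l → ∀ x, ENNReal.ofReal (β x * PhiHat a x (|u x| / l)) =
      ENNReal.ofReal (weightedDensity a β x (u x / l)) := by
    intro l hl x
    have h1 : PhiHat a x (|u x| / l) = PhiHat a x (u x / l) := by
      rw [PhiHat, PhiHat, ← Phi_abs _ _ (u x / l), abs_div, abs_of_pos hl]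
    rw [h1, weightedDensity, ENNReal.ofReal_mul' (hΦ _ _), ENNReal.ofReal_mul' (hΦ _ _)]
    congr 1
    rcases le_total 0 (β x) with h | h <;> simp [h]
  refine iInf_congr fun l => iInf_congr fun hl => ?_
  simp only [modular, this l hl]

theorem isMusielak_gagliardoDensity (hs : IsVariableOrder s) (ha : IsAdmissible a) {K : ℝ}
    (hK : 1 ≤ K) (hy : ∀ x y, IsYoung K (Phi a x y)) (μ : Measure (E N × E N)) (hμ : μ ≪ volume) :
    IsMusielak K (gagliardoDensity s a) μ where
  one_le := hK
  young p := (hy p.1 p.2).comp_mul (by positivity) _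
  aemeasurable f hf := by
    have hd : Measurable fun p : E N × E N => ‖p.1 - p.2‖ :=
      (measurable_fst.sub measurable_snd).norm
    have hk : Measurable fun p : E N × E N => (‖p.1 - p.2‖ ^ s p.1 p.2)⁻¹ * f p :=
      ((hd.pow hs.continuous.measurable).inv).mul hf
    exact (((hd.pow_const N).inv.aemeasurable).mul (ha.aemeasurable_Phi hk)).mono_ac hμ

theorem isMusielak_PhiHat (ha : IsAdmissible a) {K : ℝ} (hK : 1 ≤ K)
    (hy : ∀ x y, IsYoung K (Phi a x y)) (μ : Measure (E N)) (hμ : μ ≪ volume) :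
    IsMusielak K (PhiHat a) μ where
  one_le := hK
  young x := hy x x
  aemeasurable _ hf := (ha.aemeasurable_PhiHat hf).mono_ac hμ

theorem isMusielak_weightedDensity (ha : IsAdmissible a) {K : ℝ} (hK : 1 ≤ K)
    (hy : ∀ x y, IsYoung K (Phi a x y)) (μ : Measure (E N)) (hμ : μ ≪ volume)
    (hβ : AEMeasurable β μ) : IsMusielak K (weightedDensity a β) μ where
  one_le := hK
  young x := by
    have := (hy x x).comp_mul (le_max_right (β x) 0) 1
    simp only [one_mul] at this
    exact this
  aemeasurable f hf :=
    (hβ.max aemeasurable_const).mul ((ha.aemeasurable_PhiHat hf).mono_ac hμ)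

/-- Almost everywhere statements pull back along both projections. -/
theorem ae_fst_and_snd {P : E N → Prop} (h : ∀ᵐ x ∂(volume : Measure (E N)), P x) :
    ∀ᵐ p ∂(volume : Measure (E N × E N)), P p.1 ∧ P p.2 :=
  (Measure.quasiMeasurePreserving_fst.ae h).and (Measure.quasiMeasurePreserving_snd.ae h)

theorem isModularPair_gagliardo {K : ℝ} (h : IsMusielak K (gagliardoDensity s a)
    (volume.restrict (Ωᶜ ×ˢ Ωᶜ)ᶜ)) :
    IsModularPair (fun u : E N →ₘ[volume] ℝ => gagliardo s a Ω u) fun u =>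
      modular (gagliardoDensity s a) (volume.restrict (Ωᶜ ×ˢ Ωᶜ)ᶜ) fun p => u p.1 - u p.2 := by
  simp only [gagliardo_eq_lux]
  refine h.isModularPair (fun u p => u p.1 - u p.2)
    (fun u => (u.measurable.comp measurable_fst).sub (u.measurable.comp measurable_snd))
    (fun u v => ?_) (fun c u => ?_) (fun u v huv => ?_)
  · filter_upwards [ae_restrict_of_ae (ae_fst_and_snd (AEEqFun.coeFn_add u v))] with p hp
    rw [hp.1, hp.2, Pi.add_apply, Pi.add_apply]
    ring
  · filter_upwards [ae_restrict_of_ae (ae_fst_and_snd (AEEqFun.coeFn_smul c u))] with p hp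
    rw [hp.1, hp.2, Pi.smul_apply, Pi.smul_apply, smul_eq_mul, smul_eq_mul]
    ring
  · filter_upwards [ae_restrict_of_ae (ae_fst_and_snd huv)] with p hp
    exact hp.1.sub hp.2

theorem IsMusielak.isModularPair_restrict {K : ℝ} {ψ : E N → ℝ → ℝ} {A : Set (E N)}
    (h : IsMusielak K ψ (volume.restrict A)) :
    IsModularPair (fun u : E N →ₘ[volume] ℝ => lux ψ (volume.restrict A) u) fun u =>
      modular ψ (volume.restrict A) u := by
  refine h.isModularPair (fun u => u) (fun u => u.measurable) (fun u v => ?_) (fun c u => ?_)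
    (fun u v huv => ?_)
  · exact ae_restrict_of_ae (AEEqFun.coeFn_add u v)
  · exact ae_restrict_of_ae (AEEqFun.coeFn_smul c u)
  · exact ae_restrict_of_ae huv

/-- If a sequence converges on an open set `Ω` and its differences converge off `Ωᶜ × Ωᶜ`, then it
converges almost everywhere. -/
theorem ae_cauchySeq_of_ae_sub (hΩ : IsOpen Ω) (hΩne : Ω.Nonempty) {f : ℕ → E N → ℝ}
    (h1 : ∀ᵐ x ∂(volume.restrict Ω), CauchySeq fun k => f k x)
    (h2 : ∀ᵐ p : E N × E N ∂(volume.restrict (Ωᶜ ×ˢ Ωᶜ)ᶜ), p.1 ≠ p.2 →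
      CauchySeq fun k => f k p.1 - f k p.2) :
    ∀ᵐ x ∂(volume : Measure (E N)), CauchySeq fun k => f k x := by
  have hm : MeasurableSet (Ωᶜ ×ˢ Ωᶜ : Set (E N × E N))ᶜ :=
    (hΩ.measurableSet.compl.prod hΩ.measurableSet.compl).compl
  rw [ae_restrict_iff' hΩ.measurableSet] at h1
  rw [ae_restrict_iff' hm] at h2
  have h3 := Measure.ae_ae_of_ae_prod h2
  obtain ⟨x, hxΩ, hx1, hx2⟩ : ∃ x ∈ Ω, (x ∈ Ω → CauchySeq fun k => f k x) ∧
      ∀ᵐ y ∂(volume : Measure (E N)), (x, y) ∈ (Ωᶜ ×ˢ Ωᶜ : Set (E N × E N))ᶜ → x ≠ y →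
        CauchySeq fun k => f k x - f k y := by
    -- A nonempty open set has positive measure, so almost every condition holds somewhere in `Ω`.
    by_contra hcon
    refine (hΩ.measure_pos volume hΩne).ne' (measure_mono_null ?_ (ae_iff.1 (h1.and h3)))
    intro x hx hcon'
    exact hcon ⟨x, hx, hcon'⟩
  obtain ⟨l, hl⟩ := cauchySeq_tendsto_of_complete (hx1 hxΩ)
  filter_upwards [hx2] with y hy
  rcases eq_or_ne x y with rfl | hxy
  · exact hx1 hxΩ
  · obtain ⟨m, hm⟩ := cauchySeq_tendsto_of_complete (hy (fun hmem => hmem.1 hxΩ) hxy)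
    have := (hl.sub hm).cauchySeq
    simpa only [sub_sub_cancel] using this

end FracMusielak

theorem mainTheorem2 (N : ℕ) (hN : 1 ≤ N)
    (Ω : Set (FracMusielak.E N)) (hΩ : IsOpen Ω) (hΩne : Ω.Nonempty)
    (β : FracMusielak.E N → ℝ)
    (hβ : MemLp β ∞ (volume.restrict Ωᶜ)) (hβ0 : ∀ᵐ x ∂(volume.restrict Ωᶜ), 0 ≤ β x)
    (s : FracMusielak.E N → FracMusielak.E N → ℝ) (hs : FracMusielak.IsVariableOrder s)
    (a : FracMusielak.E N → FracMusielak.E N → ℝ → ℝ) (ha : FracMusielak.IsAdmissible a) :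
    ∃ V : Submodule ℝ (FracMusielak.E N →ₘ[volume] ℝ),
      (V : Set (FracMusielak.E N →ₘ[volume] ℝ)) = FracMusielak.X s a β Ω ∧
      FracMusielak.IsReflexiveBanachNorm
        (fun u : V => (FracMusielak.normX s a β Ω (u : FracMusielak.E N →ₘ[volume] ℝ)).toReal) := by
  obtain ⟨K, hK, hy⟩ := ha.exists_isYoung
  have hG := FracMusielak.isMusielak_gagliardoDensity hs ha hK hy
    (volume.restrict (Ωᶜ ×ˢ Ωᶜ)ᶜ) Measure.restrict_le_self.absolutelyContinuous
  have hL := FracMusielak.isMusielak_PhiHat ha hK hy (volume.restrict Ω)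
    Measure.restrict_le_self.absolutelyContinuous
  have hC := FracMusielak.isMusielak_weightedDensity ha hK hy (volume.restrict Ωᶜ)
    Measure.restrict_le_self.absolutelyContinuous hβ.aestronglyMeasurable.aemeasurable
  have pG := FracMusielak.isModularPair_gagliardo hG
  have pL := hL.isModularPair_restrict
  have pC := hC.isModularPair_restrict
  simp only [← FracMusielak.luxemburg_eq_lux] at pL
  simp only [← FracMusielak.luxemburgCompl_eq_lux (fun x t => (hy x x).nonneg t)] at pC
  have p := (pG.add pL).add pC
  refine ⟨p.submodule, rfl, p.isReflexiveBanachNorm fun u hu => ?_⟩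
  -- Only the first two terms of the norm serve here: where `β` vanishes, the third gives no
  -- control.
  refine FracMusielak.ae_cauchySeq_of_ae_sub hΩ hΩne ?_ ?_
  · have h1 := hL.ae_cauchySeq (f := fun k => u k) (fun k => (u k).measurable) fun k => by
      have h2 := (le_add_self.trans le_self_add).trans (hu k)
      rw [FracMusielak.luxemburg_eq_lux,
        FracMusielak.lux_congr (ae_restrict_of_ae (AEEqFun.coeFn_sub (u (k + 1)) (u k)))] at h2
      exact h2
    filter_upwards [h1] with x hx
    exact hx fun t ht => ha.Phi_pos x x ht
  · have h1 := hG.ae_cauchySeq (f := fun k p => u k p.1 - u k p.2)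
      (fun k => ((u k).measurable.comp measurable_fst).sub
        ((u k).measurable.comp measurable_snd)) fun k => by
      have h2 := (le_self_add.trans le_self_add).trans (hu k)
      have h3 : (fun p : FracMusielak.E N × FracMusielak.E N =>
          (u (k + 1) - u k) p.1 - (u (k + 1) - u k) p.2) =ᵐ[volume.restrict (Ωᶜ ×ˢ Ωᶜ)ᶜ]
          fun p => (u (k + 1) p.1 - u (k + 1) p.2) - (u k p.1 - u k p.2) := by
        filter_upwards [ae_restrict_of_ae (FracMusielak.ae_fst_and_snd
          (AEEqFun.coeFn_sub (u (k + 1)) (u k)))] with p hp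
        rw [hp.1, hp.2, Pi.sub_apply, Pi.sub_apply]
        ring
      rw [FracMusielak.gagliardo_eq_lux, FracMusielak.lux_congr h3] at h2
      exact h2
    filter_upwards [h1] with p hp hne
    have hd : 0 < ‖p.1 - p.2‖ := norm_pos_iff.2 (sub_ne_zero.2 hne)
    exact hp fun t ht => mul_pos (inv_pos.2 (pow_pos hd N))
      (ha.Phi_pos _ _ (mul_ne_zero (inv_pos.2 (Real.rpow_pos_of_pos hd _)).ne' ht))
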